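/- **Setting.** Let $I=(a,b)\subseteq\mathbb R$ be a nonempty open interval, possibly unbounded, and let $V(x;\alpha)$, $x\in I$, be a family of potentials depending on a multiparameter $\alpha\in D\subseteq\mathbb R^N$, where $D$ is the set of parameters for which the formulas below make sense. Let $U\subseteq D$ be the set of physical parameters, and put $\alpha_k=\alpha+k\varepsilon$ ($k\in\mathbb Z$) for a fixed $\varepsilon\in\mathbb R^N$. Write $f\sim g$ if $f=c\,g$ on $I$ for a constant $c\neq0$. Suppose that $V$ is a *translationally shape invariant potential* (TSIP) with ground level $E_0=0$. That is, for $\alpha\in D$ there is a smooth nowhere vanishing function $\psi_0(\cdot;\alpha)$ on $I$ with $-\psi_0''+V\psi_0=0$, and, with $w_0=-\psi_0'/\psi_0$, $$V(x;\alpha)+2w_0'(x;\alpha)=V(x;\alpha_1)+R(\alpha)\qquad(\alpha,\alpha_1\in D).$$ Put, for $n\ge 0$, $$E_n(\alpha)=\sum_{k=0}^{n-1}R(\alpha_k),\quad E_{-n}(\alpha)=-E_n(\alpha_{-n}),\quad \psi_n(\cdot;\alpha)=A^+(\alpha)A^+(\alpha_1)\cdots A^+(\alpha_{n-1})\,\psi_0(\cdot;\alpha_n),\quad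 A^+(\alpha)=-\tfrac{d}{dx}+w_0(x;\alpha).$$ Whenever $\alpha,\alpha_1,\dots,\alpha_n\in U$, the functions satisfying $-y''+Vy=E_n(\alpha)y$ on $I$ and the Dirichlet conditions ($y\to0$ at both ends of $I$) are exactly the multiples of $\psi_n(\cdot;\alpha)$; moreover $E_1(\alpha)>0$ if $\alpha,\alpha_1\in U$. The range $U$ is of interval type along translations: if $\alpha,\alpha_{-m}\in U$ for some $m\ge 0$, then $\alpha_{-j}\in U$ for $0\le j\le m$. Suppose also that $V$ has the $\Gamma_3$ symmetry: $-D=D$; $V(x;-\alpha)=V(x;\alpha)+\delta(\alpha)$ for $\alpha\in D$; the level $E_0$ is carried to $E_{-1}$, that is, $E_0(-\alpha)-\delta(\alpha)=E_{-1}(\alpha)$ when $\alpha,\alpha_{-1}\in D$; and, with $$\psi_{-(n+1)}(x;\alpha)=\psi_n(x;-\alpha)\qquad(n\ge0),$$ $|\psi_{-1}(\cdot;\alpha)|\to\infty$ at both ends of $I$ when $\alpha,\alpha_{-1}\in U$. (The primary TSIPs, whose bound states are classical orthogonal polynomials up to a gauge factor, are of this kind.) **Lemma.** Let $m\ge0$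 be an integer, $\alpha\in U$ and $\alpha_{-m}\in U$. Then the Wronskian $W(\psi_{-1},\dots,\psi_{-m}\mid x;\alpha)$ has no zero on $I$, and $$\psi_{k+m}(x;\alpha_{-m})\sim\frac{W(\psi_{-1},\dots,\psi_{-m},\psi_k\mid x;\alpha)}{W(\psi_{-1},\dots,\psi_{-m}\mid x;\alpha)}$$ for every integer $k\ge0$ for which $\psi_k(\cdot;\alpha)$ is defined (i.e. $\alpha,\alpha_1,\dots,\alpha_k\in D$), and $$\psi_{k+m}(x;\alpha_{-m})\sim\frac{W(\psi_{-1},\dots,\widehat{\psi_{k}},\dots,\psi_{-m}\mid x;\alpha)}{W(\psi_{-1},\dots,\psi_{-m}\mid x;\alpha)}$$ for every integer $k$ with $-m\le k<0$, where the hat means that $\psi_k$ is removed from the family. All functions on the right are taken at the parameter $\alpha$; the empty Wronskian is $1$. -/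

import Mathlib

open scoped Topology ContDiff

noncomputable section

/-- The Wronskian `W(f₀, …, f_{n-1} | x)`: the determinant with entries `f_j^{(i)}(x)`
(equal to `1` for the empty family). -/
def wronskian {n : ℕ} (f : Fin n → ℝ → ℝ) (x : ℝ) : ℝ :=
  Matrix.det (Matrix.of fun i j : Fin n => iteratedDeriv (i : ℕ) (f j) x)

/-- `f ∼ g` on `I`: equality on `I` up to a nonzero multiplicative constant. -/
def PropOn (I : Set ℝ) (f g : ℝ → ℝ) : Prop :=
  ∃ c : ℝ, c ≠ 0 ∧ ∀ x ∈ I, f x = c * g x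

/-- The data of a family of potentials `V(x; α)` on an open interval `(a, b)` (possibly unbounded),
with a multiparameter `α ∈ ℝ^N`.
* `ε` is the translation of the parameter in the shape invariance condition;
* `D` is the set of all parameters for which the formulas for `V(x; α)`, `ψ₀(x; α)` make sense;
* `U` is the set of the parameters for which `ψ₀(x; α)` is a physical ground state;
* `R` is the constant in the shape invariance condition.
The laws relating these data are in `IsTSIP` and `HasGammaThree` below. -/
structure PotentialFamily (N : ℕ) where
  a : EReal
  b : EReal
  ε : Fin N → ℝ
  D : Set (Fin N → ℝ)
  U : Set (Fin N → ℝ)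
  V : (Fin N → ℝ) → ℝ → ℝ
  ψ₀ : (Fin N → ℝ) → ℝ → ℝ
  R : (Fin N → ℝ) → ℝ

namespace PotentialFamily

variable {N : ℕ} (T : PotentialFamily N)

/-- The open interval on which the potentials live. -/
def I : Set ℝ := {x | T.a < (x : EReal) ∧ (x : EReal) < T.b}

/-- The filter of neighbourhoods of the left end of the interval. -/
def leftEnd : Filter ℝ := Filter.comap (fun x : ℝ => (x : EReal)) (𝓝[>] T.a)

/-- The filter of neighbourhoods of the right end of the interval. -/
def rightEnd : Filter ℝ := Filter.comap (fun x : ℝ => (x : EReal)) (𝓝[<] T.b)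

/-- The translated parameter `α_k = α + k ε`, for every integer `k`. -/
def shift (k : ℤ) (α : Fin N → ℝ) : Fin N → ℝ := α + (k : ℝ) • T.ε

/-- `w₀(x; α) = - ψ₀'(x; α) / ψ₀(x; α)`. -/
def w₀ (α : Fin N → ℝ) (x : ℝ) : ℝ := - deriv (T.ψ₀ α) x / T.ψ₀ α x

/-- The operator `A⁺(α) = - d/dx + w₀(x; α)`. -/
def Aplus (α : Fin N → ℝ) (f : ℝ → ℝ) (x : ℝ) : ℝ := - deriv f x + T.w₀ α x * f x

/-- `ψ_n(x; α) = A⁺(α) A⁺(α_1) ⋯ A⁺(α_{n-1}) ψ₀(x; α_n)` for `n ≥ 0`. -/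
def ψNat : ℕ → (Fin N → ℝ) → ℝ → ℝ
  | 0, α => T.ψ₀ α
  | n + 1, α => T.Aplus α (ψNat n (T.shift 1 α))

/-- The eigenfunctions indexed by all integers; for negative indices they are obtained by the
substitution `α ↦ -α`: `ψ_{-(n+1)}(x; α) = ψ_n(x; -α)`. -/
def ψ : ℤ → (Fin N → ℝ) → ℝ → ℝ
  | Int.ofNat n, α => T.ψNat n α
  | Int.negSucc n, α => T.ψNat n (-α)

/-- The dispersion relation `E_n(α) = ∑_{k<n} R(α_k)` for `n ≥ 0`, extended to negative indices by
the rule `E_{n+m}(α) - E_m(α) = E_n(α_m)`, which forces `E_{-n}(α) = - E_n(α_{-n})`. -/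
def E : ℤ → (Fin N → ℝ) → ℝ
  | Int.ofNat n, α => ∑ k ∈ Finset.range n, T.R (T.shift k α)
  | Int.negSucc n, α =>
      - ∑ k ∈ Finset.range (n + 1), T.R (T.shift k (T.shift (Int.negSucc n) α))

/-- `y` is a (formal) eigenfunction of `-d²/dx² + V(x; α)` on the interval, for the value `e`. -/
def IsEigenfunction (α : Fin N → ℝ) (e : ℝ) (y : ℝ → ℝ) : Prop :=
  ContDiffOn ℝ 2 y T.I ∧ ∀ x ∈ T.I, - deriv (deriv y) x + T.V α x * y x = e * y x

/-- Dirichlet boundary conditions at both ends of the interval. -/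
def Dirichlet (y : ℝ → ℝ) : Prop :=
  Filter.Tendsto y T.leftEnd (𝓝 0) ∧ Filter.Tendsto y T.rightEnd (𝓝 0)

/-- Translationally shape invariant potentials. -/
structure IsTSIP : Prop where
  lt : T.a < T.b
  U_subset : T.U ⊆ T.D
  /-- The range of the parameters meets each line of translates in an interval. -/
  U_interval : ∀ α ∈ T.U, ∀ m : ℕ, T.shift (-m) α ∈ T.U →
    ∀ j : ℕ, j ≤ m → T.shift (-j) α ∈ T.U
  smooth : ∀ α ∈ T.D, ContDiffOn ℝ ∞ (T.ψ₀ α) T.I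
  nodeless : ∀ α ∈ T.D, ∀ x ∈ T.I, T.ψ₀ α x ≠ 0
  /-- `ψ₀(x; α)` is an eigenfunction for `E₀(α) = 0`. -/
  ground : ∀ α ∈ T.D, T.IsEigenfunction α 0 (T.ψ₀ α)
  /-- Shape invariance: `V(x; α) + 2 w₀'(x; α) = V(x; α_1) + R(α)`. -/
  shape_invariance : ∀ α ∈ T.D, T.shift 1 α ∈ T.D → ∀ x ∈ T.I,
    T.V α x + 2 * deriv (T.w₀ α) x = T.V (T.shift 1 α) x + T.R α
  /-- In the physical range the `ψ_n(x; α)` are the bound states for the simple levels `E_n(α)` of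
  the Dirichlet problem. -/
  bound_states : ∀ α ∈ T.U, ∀ n : ℕ, (∀ j : ℕ, j ≤ n → T.shift j α ∈ T.U) → ∀ y : ℝ → ℝ,
    (T.IsEigenfunction α (T.E n α) y ∧ T.Dirichlet y) ↔
      ∃ c : ℝ, ∀ x ∈ T.I, y x = c * T.ψ n α x
  /-- The ground level `0` lies below the first excited level. -/
  E_one_pos : ∀ α ∈ T.U, T.shift 1 α ∈ T.U → 0 < T.E 1 α

/-- The reflection `α ↦ -α` is a symmetry of the family that takes the level `E_0` to `E_{-1}`
(hence, by shape invariance, each `E_n` to `E_{-(n+1)}`), and the reflected ground state diverges at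
both ends of the interval. -/
structure HasGammaThree : Prop where
  neg_mem : ∀ α ∈ T.D, -α ∈ T.D
  covariance : ∃ δ : (Fin N → ℝ) → ℝ,
    (∀ α ∈ T.D, ∀ x ∈ T.I, T.V (-α) x = T.V α x + δ α) ∧
    (∀ α ∈ T.D, T.shift (-1) α ∈ T.D → T.E 0 (-α) - δ α = T.E (-1) α)
  diverges : ∀ α ∈ T.U, T.shift (-1) α ∈ T.U →
    Filter.Tendsto (fun x => |T.ψ (-1) α x|) T.leftEnd Filter.atTop ∧
    Filter.Tendsto (fun x => |T.ψ (-1) α x|) T.rightEnd Filter.atTop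

/-- `W^{(L)}(x; α) = W(ψ_{l_1}, …, ψ_{l_r} | x; α)` for a tuple `L = (l_1, …, l_r)` of integers. -/
def W (L : List ℤ) (α : Fin N → ℝ) (x : ℝ) : ℝ :=
  wronskian (fun j : Fin L.length => T.ψ (L.get j) α) x

end PotentialFamily

/-- The tuple `-M = (-1, …, -m)`. -/
def negTuple (m : ℕ) : List ℤ := (List.range m).map fun i : ℕ => -((i : ℤ) + 1)

end

/-! Induction on `m`, lowering the parameter by one translation each time. The reciprocal of `ψ₀
(-α)` solves the ground state equation at α₋₁ and tends to zero at both ends, so it is a multiple of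
`ψ₀` there (`ψ₀_neg`). Hence `w₀ (-α)` is minus `w₀` at α₋₁, and the Darboux transformation with
seed ψ₋₁(α) is -A⁺(α₋₁). This operator sends ψₖ(α) to a nonzero multiple of ψₖ₊₁(α₋₁): by definition
for k ≥ 0, and for k ≤ -2 because A⁺A⁻ = H and the negative levels do not vanish.

Pulling the first column out of a Wronskian (`wronskian_cons`) thus turns each Wronskian at α
containing ψ₋₁ into a constant times `ψ₀ (-α)` times a shorter one at α₋₁ (`W_neg_one_cons`). The
common factor cancels in the quotients. Only the family with ψ₋₁ removed needs another argument: it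
is the Darboux transform, with seed ψ₀(α₋₁), of the family at α₋₁ (`W_map_sub_one`), so its case
reduces to adjoining ψ₀ one step lower. -/

/-! ### Wronskian identities. -/

theorem wronskian_congr_const_mul {n : ℕ} {S : Set ℝ} (hS : IsOpen S) (c : Fin n → ℝ)
    {f g : Fin n → ℝ → ℝ} (h : ∀ j, ∀ x ∈ S, f j x = c j * g j x) {x : ℝ} (hx : x ∈ S) :
    wronskian f x = (∏ j, c j) * wronskian g x := by
  unfold wronskian
  rw [← Matrix.det_mul_row]
  congr 1
  ext i j
  have he : f j =ᶠ[𝓝 x] fun y => c j * g j y :=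
    Filter.eventually_of_mem (hS.mem_nhds hx) (h j)
  simp only [Matrix.of_apply]
  rw [he.iteratedDeriv_eq, iteratedDeriv_const_mul_field]

theorem wronskian_congr {n : ℕ} {S : Set ℝ} (hS : IsOpen S)
    {f g : Fin n → ℝ → ℝ} (h : ∀ j, ∀ x ∈ S, f j x = g j x) {x : ℝ} (hx : x ∈ S) :
    wronskian f x = wronskian g x := by
  simpa using wronskian_congr_const_mul hS (fun _ => 1) (by simpa using h) hx

theorem wronskian_comp_cast {m n : ℕ} (h : m = n) (f : Fin n → ℝ → ℝ) :
    wronskian (fun j : Fin m => f (Fin.cast h j)) = wronskian f := by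
  subst h
  rfl

/-- By the Leibniz rule the new matrix is `L` times the old one, with `L` lower triangular and φ on
its diagonal. -/
theorem wronskian_mul {n : ℕ} {f : Fin n → ℝ → ℝ} {φ : ℝ → ℝ} {x : ℝ}
    (hf : ∀ j, ContDiffAt ℝ ∞ (f j) x) (hφ : ContDiffAt ℝ ∞ φ x) :
    wronskian (fun j y => f j y * φ y) x = φ x ^ n * wronskian f x := by
  let L : Matrix (Fin n) (Fin n) ℝ := Matrix.of fun i k =>
    ((i : ℕ).choose k : ℝ) * iteratedDeriv ((i : ℕ) - k) φ x
  have hL : L.det = φ x ^ n := by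
    rw [Matrix.det_of_isLowerTriangular]
    · simp [L]
    · intro i k hik
      have : (i : ℕ) < k := hik
      simp [L, Nat.choose_eq_zero_of_lt this]
  unfold wronskian
  rw [← hL, ← Matrix.det_mul]
  congr 1
  ext i j
  simp only [Matrix.of_apply, Matrix.mul_apply, L]
  rw [iteratedDeriv_fun_mul ((hf j).of_le (by exact_mod_cast le_top))
    (hφ.of_le (by exact_mod_cast le_top)),
    Finset.sum_subset (Finset.range_subset_range.2 (Nat.succ_le_of_lt i.2)) fun k _ hk => by
      rw [Nat.choose_eq_zero_of_lt (by simpa using hk)]; simp,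
    Finset.sum_range]
  exact Finset.sum_congr rfl fun k _ => by ring

theorem wronskian_one_cons {n : ℕ} (f : Fin n → ℝ → ℝ) (x : ℝ) :
    wronskian (Fin.cons (fun _ => 1) f : Fin (n + 1) → ℝ → ℝ) x =
      wronskian (fun j => deriv (f j)) x := by
  unfold wronskian
  rw [Matrix.det_succ_column_zero, Fin.sum_univ_succ, Finset.sum_eq_zero]
  · simp only [Fin.val_zero, pow_zero, Matrix.of_apply, Fin.cons_zero, iteratedDeriv_zero, one_mul,
      add_zero]
    congr 1
    ext i j
    simp [iteratedDeriv_succ']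
  · intro i _
    simp [iteratedDeriv_const]

/-- Reduction of order: dividing all entries by φ makes the first one the constant 1, and φ·(f/φ)′
is the Darboux transform of f with seed φ. -/
theorem wronskian_cons {n : ℕ} {S : Set ℝ} (hS : IsOpen S) {f : Fin n → ℝ → ℝ} {φ : ℝ → ℝ}
    (hf : ∀ j, ContDiffOn ℝ ∞ (f j) S) (hφ : ContDiffOn ℝ ∞ φ S) (h0 : ∀ x ∈ S, φ x ≠ 0)
    {x : ℝ} (hx : x ∈ S) :
    wronskian (Fin.cons φ f : Fin (n + 1) → ℝ → ℝ) x =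
      φ x * wronskian (fun j y => deriv (f j) y - deriv φ y / φ y * f j y) x := by
  have hg : ∀ j, ContDiffOn ℝ ∞ (fun y => f j y / φ y) S := fun j => (hf j).div hφ h0
  have hg' : ∀ j, ContDiffOn ℝ ∞ (deriv fun y => f j y / φ y) S := fun j =>
    (hg j).deriv_of_isOpen hS (by simp)
  have h1 : wronskian (Fin.cons φ f : Fin (n + 1) → ℝ → ℝ) x =
      wronskian (fun j y =>
        (Fin.cons (fun _ => 1) (fun j y => f j y / φ y) : Fin (n + 1) → ℝ → ℝ) j y * φ y) x := by
    refine wronskian_congr hS (fun j => ?_) hx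
    refine Fin.cases ?_ (fun j => ?_) j
    · simp
    · intro y hy
      simp [div_mul_cancel₀ _ (h0 y hy)]
  have h2 : wronskian (fun j y => deriv (f j) y - deriv φ y / φ y * f j y) x =
      wronskian (fun j y => deriv (fun z => f j z / φ z) y * φ y) x := by
    refine wronskian_congr hS (fun j y hy => ?_) hx
    have hy' := hS.mem_nhds hy
    rw [deriv_fun_div (((hf j).contDiffAt hy').differentiableAt (by simp))
      ((hφ.contDiffAt hy').differentiableAt (by simp)) (h0 y hy)]
    field_simp [h0 y hy]
  have hx' := hS.mem_nhds hx
  rw [h1, h2, wronskian_mul _ (hφ.contDiffAt hx'), wronskian_one_cons,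
    wronskian_mul (fun j => (hg' j).contDiffAt hx') (hφ.contDiffAt hx'), pow_succ]
  · ring
  · refine fun j => Fin.cases ?_ (fun j => ?_) j
    · simpa using contDiffAt_const
    · simpa using (hg j).contDiffAt hx'

theorem wronskian_snoc {n : ℕ} (f : Fin n → ℝ → ℝ) (φ : ℝ → ℝ) (x : ℝ) :
    wronskian (Fin.snoc f φ : Fin (n + 1) → ℝ → ℝ) x =
      (-1) ^ n * wronskian (Fin.cons φ f : Fin (n + 1) → ℝ → ℝ) x := by
  have := Matrix.det_permute' (finRotate (n + 1))
    (Matrix.of fun i j : Fin (n + 1) =>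
      iteratedDeriv (i : ℕ) ((Fin.cons φ f : Fin (n + 1) → ℝ → ℝ) j) x)
  rw [sign_finRotate] at this
  unfold wronskian
  rw [Fin.snoc_eq_cons_rotate]
  refine Eq.trans ?_ (this.trans (by simp))
  rfl

/-! ### Wronskians indexed by lists of integers. -/

namespace PotentialFamily

variable {N : ℕ} (T : PotentialFamily N)

theorem isOpen_I : IsOpen T.I :=
  (isOpen_lt continuous_const continuous_coe_real_ereal).inter
    (isOpen_lt continuous_coe_real_ereal continuous_const)

theorem W_cons_eq (k : ℤ) (L : List ℤ) (α : Fin N → ℝ) :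
    T.W (k :: L) α = wronskian (Fin.cons (T.ψ k α) (fun j : Fin L.length => T.ψ (L.get j) α) :
      Fin (L.length + 1) → ℝ → ℝ) := by
  have : (fun j => T.ψ ((k :: L).get j) α) =
      (Fin.cons (T.ψ k α) (fun j : Fin L.length => T.ψ (L.get j) α) :
        Fin (L.length + 1) → ℝ → ℝ) :=
    funext fun j => Fin.cases rfl (fun j => rfl) j
  unfold W
  rw [← this]

theorem W_nil (α : Fin N → ℝ) (x : ℝ) : T.W [] α x = 1 :=
  Matrix.det_fin_zero

theorem W_singleton (k : ℤ) (α : Fin N → ℝ) (x : ℝ) : T.W [k] α x = T.ψ k α x :=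
  (Matrix.det_fin_one _).trans (by simp)

theorem W_append_singleton (k : ℤ) (L : List ℤ) (α : Fin N → ℝ) (x : ℝ) :
    T.W (L ++ [k]) α x = (-1) ^ L.length * T.W (k :: L) α x := by
  rw [W_cons_eq, ← wronskian_snoc, ← wronskian_comp_cast (show (L ++ [k]).length = L.length + 1 by simp)]
  unfold W
  congr 1
  funext j
  rcases lt_or_ge (j : ℕ) L.length with h | h
  · have : Fin.cast (show (L ++ [k]).length = L.length + 1 by simp) j
        = Fin.castSucc ⟨j, h⟩ := rfl
    rw [this, Fin.snoc_castSucc]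
    simp [List.getElem_append_left h]
  · have hj : (j : ℕ) = L.length := le_antisymm (by have := j.2; simp at this; omega) h
    have : Fin.cast (show (L ++ [k]).length = L.length + 1 by simp) j = Fin.last _ :=
      Fin.ext hj
    rw [this, Fin.snoc_last]
    simp [hj]

theorem W_map (g : ℤ → ℤ) (L : List ℤ) (α : Fin N → ℝ) :
    T.W (L.map g) α = wronskian (fun j : Fin L.length => T.ψ (g (L.get j)) α) := by
  rw [← wronskian_comp_cast (show (L.map g).length = L.length by simp)]
  unfold W
  simp

end PotentialFamily

theorem negTuple_succ (m : ℕ) : negTuple (m + 1) = -1 :: (negTuple m).map (· - 1) := by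
  simp only [negTuple, List.range_succ_eq_map, List.map_cons, List.map_map]
  refine congrArg₂ _ (by simp) (List.map_congr_left fun i _ => ?_)
  simp
  ring

theorem exists_of_mem_negTuple {m : ℕ} {l : ℤ} (h : l ∈ negTuple m) :
    ∃ n : ℕ, n < m ∧ l = Int.negSucc n := by
  simp only [negTuple, List.mem_map, List.mem_range] at h
  obtain ⟨n, hn, rfl⟩ := h
  exact ⟨n, hn, by rw [Int.negSucc_eq]⟩

/-! ### Ladder operators, with A⁻ = d/dx + w₀, and the negative levels. -/

namespace PotentialFamily

variable {N : ℕ} {T : PotentialFamily N}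

theorem shift_shift (j k : ℤ) (α : Fin N → ℝ) : T.shift j (T.shift k α) = T.shift (j + k) α := by
  simp only [shift, Int.cast_add, add_smul]
  abel

theorem shift_zero (α : Fin N → ℝ) : T.shift 0 α = α := by simp [shift]

theorem shift_neg_arg (k : ℤ) (α : Fin N → ℝ) : T.shift k (-α) = -T.shift (-k) α := by
  simp only [shift, Int.cast_neg, neg_smul]
  abel

theorem deriv_congr_on {f g : ℝ → ℝ} (h : ∀ x ∈ T.I, f x = g x) {x : ℝ} (hx : x ∈ T.I) :
    deriv f x = deriv g x :=
  Filter.EventuallyEq.deriv_eq (Filter.eventually_of_mem (T.isOpen_I.mem_nhds hx) h)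

theorem differentiableAt_of_smooth {f : ℝ → ℝ} (hf : ContDiffOn ℝ ∞ f T.I) {x : ℝ} (hx : x ∈ T.I) :
    DifferentiableAt ℝ f x :=
  (hf.contDiffAt (T.isOpen_I.mem_nhds hx)).differentiableAt (by simp)

theorem smooth_deriv {f : ℝ → ℝ} (hf : ContDiffOn ℝ ∞ f T.I) : ContDiffOn ℝ ∞ (deriv f) T.I :=
  hf.deriv_of_isOpen T.isOpen_I (by simp)

namespace IsTSIP

variable (hT : T.IsTSIP)
include hT

theorem exists_mem_I : ∃ x, x ∈ T.I := by
  obtain ⟨x, h⟩ := EReal.lt_iff_exists_real_btwn.1 hT.lt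
  exact ⟨x, h⟩

theorem smooth_w₀ {α : Fin N → ℝ} (hα : α ∈ T.D) : ContDiffOn ℝ ∞ (T.w₀ α) T.I :=
  (smooth_deriv (hT.smooth α hα)).neg.div (hT.smooth α hα) (hT.nodeless α hα)

theorem deriv_ψ₀ {α : Fin N → ℝ} (hα : α ∈ T.D) {x : ℝ} (hx : x ∈ T.I) :
    deriv (T.ψ₀ α) x = -(T.w₀ α x * T.ψ₀ α x) := by
  have := hT.nodeless α hα x hx
  simp only [w₀]
  field_simp

/-- The Riccati equation for `w₀`. -/
theorem deriv_w₀ {α : Fin N → ℝ} (hα : α ∈ T.D) {x : ℝ} (hx : x ∈ T.I) :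
    deriv (T.w₀ α) x = T.w₀ α x ^ 2 - T.V α x := by
  have h0 := hT.nodeless α hα x hx
  have h2 := (hT.ground α hα).2 x hx
  rw [deriv_congr_on (fun y hy => hT.deriv_ψ₀ hα hy) hx, deriv.fun_neg,
    deriv_fun_mul (differentiableAt_of_smooth (hT.smooth_w₀ hα) hx)
      (differentiableAt_of_smooth (hT.smooth α hα) hx), hT.deriv_ψ₀ hα hx] at h2
  apply mul_right_cancel₀ h0
  linear_combination h2

theorem smooth_Aplus {α : Fin N → ℝ} (hα : α ∈ T.D) {f : ℝ → ℝ} (hf : ContDiffOn ℝ ∞ f T.I) :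
    ContDiffOn ℝ ∞ (T.Aplus α f) T.I :=
  (smooth_deriv hf).neg.add ((hT.smooth_w₀ hα).mul hf)

theorem smooth_ψNat {n : ℕ} {α : Fin N → ℝ} (h : ∀ j : ℕ, j ≤ n → T.shift j α ∈ T.D) :
    ContDiffOn ℝ ∞ (T.ψNat n α) T.I := by
  induction n generalizing α with
  | zero => exact hT.smooth α (by simpa [shift_zero] using h 0 le_rfl)
  | succ n ih =>
    refine hT.smooth_Aplus (by simpa [shift_zero] using h 0 (Nat.zero_le _)) (ih fun j hj => ?_)
    rw [shift_shift]
    exact_mod_cast h (j + 1) (by omega)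

/-- `A⁺ A⁻ = H`, applied to `y` with `H y = e y`; here `g = - A⁻ y`. -/
theorem Aplus_neg_Aminus {α : Fin N → ℝ} (hα : α ∈ T.D) {e : ℝ} {y g : ℝ → ℝ}
    (hy : ContDiffOn ℝ ∞ y T.I) (he : T.IsEigenfunction α e y)
    (hg : ∀ x ∈ T.I, g x = -(deriv y x + T.w₀ α x * y x)) {x : ℝ} (hx : x ∈ T.I) :
    T.Aplus α g x = -e * y x := by
  have h2 := he.2 x hx
  have hd : deriv g x = -(deriv (deriv y) x + (deriv (T.w₀ α) x * y x + T.w₀ α x * deriv y x)) := by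
    rw [deriv_congr_on hg hx, deriv.fun_neg,
      deriv_fun_add (differentiableAt_of_smooth (smooth_deriv hy) hx)
        ((differentiableAt_of_smooth (hT.smooth_w₀ hα) hx).fun_mul (differentiableAt_of_smooth hy hx)),
      deriv_fun_mul (differentiableAt_of_smooth (hT.smooth_w₀ hα) hx)
        (differentiableAt_of_smooth hy hx)]
  rw [Aplus, hd, hg x hx, hT.deriv_w₀ hα hx]
  linear_combination -h2

/-- `A⁻(α)` intertwines `H(α)` with `H(α₁) + R(α)`. -/
theorem isEigenfunction_neg_Aminus {α : Fin N → ℝ} (hα : α ∈ T.D) (hα' : T.shift 1 α ∈ T.D) {e : ℝ}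
    {y g : ℝ → ℝ} (hy : ContDiffOn ℝ ∞ y T.I) (hgs : ContDiffOn ℝ ∞ g T.I)
    (he : T.IsEigenfunction α e y)
    (hg : ∀ x ∈ T.I, g x = -(deriv y x + T.w₀ α x * y x)) :
    T.IsEigenfunction (T.shift 1 α) (e - T.R α) g := by
  refine ⟨by exact_mod_cast contDiffOn_infty.1 hgs 2, fun x hx => ?_⟩
  have h1 : ∀ x ∈ T.I, deriv g x = T.w₀ α x * g x + e * y x := fun x hx => by
    have := hT.Aplus_neg_Aminus hα hy he hg hx
    rw [Aplus] at this
    linear_combination -this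
  have hw := differentiableAt_of_smooth (hT.smooth_w₀ hα) hx
  have hgd := differentiableAt_of_smooth hgs hx
  have hyd := differentiableAt_of_smooth hy hx
  rw [deriv_congr_on h1 hx, deriv_fun_add (hw.fun_mul hgd) (hyd.const_mul e), deriv_fun_mul hw hgd,
    deriv_const_mul e hyd, h1 x hx]
  have hs := hT.shape_invariance α hα hα' x hx
  have hr := hT.deriv_w₀ hα hx
  linear_combination (-g x) * hs + g x * hr - e * hg x hx

theorem R_pos {α : Fin N → ℝ} (hα : α ∈ T.U) (hα' : T.shift 1 α ∈ T.U) : 0 < T.R α := by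
  have := hT.E_one_pos α hα hα'
  rw [show T.E 1 α = ∑ k ∈ Finset.range 1, T.R (T.shift k α) from rfl] at this
  simpa [shift_zero] using this

theorem mem_U {α : Fin N → ℝ} (hα : α ∈ T.U) {m : ℕ} (hm : T.shift (-m) α ∈ T.U) {j : ℤ}
    (h1 : -(m : ℤ) ≤ j) (h2 : j ≤ 0) : T.shift j α ∈ T.U := by
  obtain ⟨i, rfl⟩ : ∃ i : ℕ, j = -i := ⟨j.natAbs, by omega⟩
  exact hT.U_interval α hα m hm i (by omega)

/-- The summands are gaps `R` between consecutive translates, all physical by `U_interval`. This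
makes the factors produced by A⁺A⁻ nonzero. -/
theorem E_negSucc_neg {α : Fin N → ℝ} (hα : α ∈ T.U) {n : ℕ}
    (hn : T.shift (Int.negSucc n) α ∈ T.U) : T.E (Int.negSucc n) α < 0 := by
  rw [Int.negSucc_eq] at hn
  have hn' : T.shift (-((n + 1 : ℕ) : ℤ)) α ∈ T.U := by exact_mod_cast hn
  simp only [E, neg_lt_zero, shift_shift]
  refine Finset.sum_pos (fun k hk => ?_) (by simp)
  have hk' := Finset.mem_range.1 hk
  refine hT.R_pos (hT.mem_U hα hn' ?_ ?_) ?_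
  · rw [Int.negSucc_eq]; omega
  · rw [Int.negSucc_eq]; omega
  · rw [shift_shift]
    refine hT.mem_U hα hn' ?_ ?_ <;> rw [Int.negSucc_eq] <;> omega

end IsTSIP

/-- Matches the shift of the energy caused by A⁻(α₋₁). -/
theorem E_negSucc_succ (n : ℕ) (α : Fin N → ℝ) :
    T.E (Int.negSucc (n + 1)) α =
      T.E (Int.negSucc n) (T.shift (-1) α) - T.R (T.shift (-1) α) := by
  simp only [E, shift_shift]
  have h1 : Int.negSucc (n + 1) = Int.negSucc n + -1 := by
    simp only [Int.negSucc_eq]; push_cast; ring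
  have h2 : ((n + 1 : ℕ) : ℤ) + (Int.negSucc n + -1) = -1 := by
    simp only [Int.negSucc_eq]; push_cast; ring
  rw [Finset.sum_range_succ, h1, h2]
  ring

/-! ### The reflected states. -/

namespace HasGammaThree

variable (hΓ : T.HasGammaThree) {α : Fin N → ℝ}
include hΓ

/-- Carrying the level E₀ to E₋₁ forces the value of the constant δ. -/
theorem V_neg (hα : α ∈ T.D) (hα' : T.shift (-1) α ∈ T.D) {x : ℝ} (hx : x ∈ T.I) :
    T.V (-α) x = T.V α x + T.R (T.shift (-1) α) := by
  obtain ⟨δ, h1, h2⟩ := hΓ.covariance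
  have hδ := h2 α hα hα'
  rw [show T.E 0 (-α) = 0 from by simp [E],
    show T.E (-1) α = -∑ k ∈ Finset.range (0 + 1), T.R (T.shift k (T.shift (-1) α)) from rfl] at hδ
  simp [shift_zero] at hδ
  rw [h1 α hα x hx, hδ]

theorem V_neg' (hα : α ∈ T.D) (hα' : T.shift 1 α ∈ T.D) {x : ℝ} (hx : x ∈ T.I) :
    T.V (-α) x = T.V α x - T.R (-T.shift 1 α) := by
  have := hΓ.V_neg (hΓ.neg_mem α hα)
    (by rw [shift_neg_arg]; simpa using hΓ.neg_mem _ hα') hx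
  rw [neg_neg, shift_neg_arg, neg_neg] at this
  linear_combination -this

variable (hT : T.IsTSIP)
include hT

/-- The reflected ground state is the reciprocal of the translated one. -/
theorem ψ₀_neg (hα : α ∈ T.U) (hα' : T.shift (-1) α ∈ T.U) :
    ∃ c : ℝ, c ≠ 0 ∧ ∀ x ∈ T.I, T.ψ₀ (-α) x * T.ψ₀ (T.shift (-1) α) x = c := by
  have hD := hT.U_subset hα
  have hD' := hT.U_subset hα'
  have hn := hΓ.neg_mem α hD
  have hn' := hΓ.neg_mem _ hD'
  have h0 := hT.nodeless _ hn
  have hs : T.shift 1 (T.shift (-1) α) = α := by simp [shift_shift, shift_zero]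
  have hus : ContDiffOn ℝ ∞ (fun x => (T.ψ₀ (-α) x)⁻¹) T.I := (hT.smooth _ hn).inv h0
  have hu1 : ∀ x ∈ T.I, deriv (fun x => (T.ψ₀ (-α) x)⁻¹) x = T.w₀ (-α) x * (T.ψ₀ (-α) x)⁻¹ := by
    intro x hx
    have := h0 x hx
    rw [deriv_fun_inv'' (differentiableAt_of_smooth (hT.smooth _ hn) hx) this, w₀]
    field_simp
  have heig : T.IsEigenfunction (T.shift (-1) α) (T.E (0 : ℕ) (T.shift (-1) α))
      (fun x => (T.ψ₀ (-α) x)⁻¹) := by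
    refine ⟨by exact_mod_cast contDiffOn_infty.1 hus 2, fun x hx => ?_⟩
    rw [show T.E (0 : ℕ) (T.shift (-1) α) = 0 by simp [E],
      deriv_congr_on hu1 hx, deriv_fun_mul (differentiableAt_of_smooth (hT.smooth_w₀ hn) hx)
        (differentiableAt_of_smooth hus hx), hu1 x hx]
    -- With u = 1/ψ₀(-α), u″ = (w₀′ + w₀²)u = (V + 2w₀′)u at -α; the term `R (-α)` from shape
    -- invariance cancels the one from the reflection.
    have e1 := hT.deriv_w₀ hn hx
    have e2 := hT.shape_invariance _ hn (by rw [shift_neg_arg]; exact hn') x hx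
    have e3 := hΓ.V_neg' hD' (by rwa [hs]) hx
    rw [hs] at e3
    rw [shift_neg_arg] at e2
    linear_combination (T.ψ₀ (-α) x)⁻¹ * (e1 - e2 - e3)
  have hdir : T.Dirichlet (fun x => (T.ψ₀ (-α) x)⁻¹) := by
    obtain ⟨hl, hr⟩ := hΓ.diverges α hα hα'
    constructor
    · rw [tendsto_zero_iff_abs_tendsto_zero]
      simp only [Function.comp_def, abs_inv]
      exact hl.inv_tendsto_atTop
    · rw [tendsto_zero_iff_abs_tendsto_zero]
      simp only [Function.comp_def, abs_inv]
      exact hr.inv_tendsto_atTop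
  -- Simplicity of the ground level at α₋₁.
  obtain ⟨c, hc⟩ := (hT.bound_states _ hα' 0 (fun j hj => by
    obtain rfl : j = 0 := by omega
    simpa [shift_zero] using hα') _).1 ⟨heig, hdir⟩
  have hc' : ∀ x ∈ T.I, (T.ψ₀ (-α) x)⁻¹ = c * T.ψ₀ (T.shift (-1) α) x := hc
  have hc0 : c ≠ 0 := by
    rintro rfl
    obtain ⟨x, hx⟩ := hT.exists_mem_I
    have := hc' x hx
    rw [zero_mul, inv_eq_zero] at this
    exact h0 x hx this
  refine ⟨c⁻¹, inv_ne_zero hc0, fun x hx => ?_⟩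
  have h1 := hc' x hx
  have := h0 x hx
  field_simp at h1 ⊢
  linear_combination -h1

theorem w₀_neg (hα : α ∈ T.U) (hα' : T.shift (-1) α ∈ T.U) {x : ℝ} (hx : x ∈ T.I) :
    T.w₀ (-α) x = -T.w₀ (T.shift (-1) α) x := by
  obtain ⟨c, hc0, hc⟩ := hΓ.ψ₀_neg hT hα hα'
  have hD' := hT.U_subset hα'
  have hn := hΓ.neg_mem α (hT.U_subset hα)
  have hd := deriv_congr_on hc hx
  rw [deriv_fun_mul (differentiableAt_of_smooth (hT.smooth _ hn) hx)
    (differentiableAt_of_smooth (hT.smooth _ hD') hx), deriv_const, hT.deriv_ψ₀ hn hx,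
    hT.deriv_ψ₀ hD' hx] at hd
  apply mul_right_cancel₀ hc0
  linear_combination (-(T.w₀ (-α) x) - T.w₀ (T.shift (-1) α) x) * hc x hx - hd

/-- The operator `A⁻(α₋₁)` lowers the states of negative index. -/
theorem ψNat_succ_neg (hα : α ∈ T.U) (hα' : T.shift (-1) α ∈ T.U) (n : ℕ) {x : ℝ} (hx : x ∈ T.I) :
    T.ψNat (n + 1) (-α) x = -(deriv (T.ψNat n (-T.shift (-1) α)) x +
      T.w₀ (T.shift (-1) α) x * T.ψNat n (-T.shift (-1) α) x) := by
  rw [ψNat, Aplus, shift_neg_arg, hΓ.w₀_neg hT hα hα' hx]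
  ring

theorem smooth_ψNat_neg (hα : α ∈ T.U) {n : ℕ} (hn : T.shift (-(n : ℤ)) α ∈ T.U) :
    ContDiffOn ℝ ∞ (T.ψNat n (-α)) T.I :=
  hT.smooth_ψNat fun j hj => by
    rw [shift_neg_arg]
    exact hΓ.neg_mem _ (hT.U_subset (hT.mem_U hα hn (by omega) (by omega)))

/-- Reflection gives the first state; each further one arises by -A⁻(α₋₁) from its predecessor at
α₋₁. -/
theorem isEigenfunction_ψNat_neg (hα : α ∈ T.U) {n : ℕ}
    (hn : T.shift (Int.negSucc n) α ∈ T.U) :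
    T.IsEigenfunction α (T.E (Int.negSucc n) α) (T.ψNat n (-α)) := by
  induction n generalizing α with
  | zero =>
    have hD := hT.U_subset hα
    have hg := hT.ground _ (hΓ.neg_mem α hD)
    refine ⟨hg.1, fun x hx => ?_⟩
    have h1 := hg.2 x hx
    have h2 := hΓ.V_neg hD (hT.U_subset hn) hx
    have h3 : T.E (Int.negSucc 0) α = -T.R (T.shift (-1) α) := by
      simp [E, shift_zero]
    rw [h3, ψNat]
    linear_combination h1 - T.ψ₀ (-α) x * h2
  | succ n ih =>
    have hn' : T.shift (-((n + 2 : ℕ) : ℤ)) α ∈ T.U := hn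
    have hα' : T.shift (-1) α ∈ T.U := hT.mem_U hα hn' (by omega) (by omega)
    have hs : T.shift 1 (T.shift (-1) α) = α := by simp [shift_shift, shift_zero]
    have hm : T.shift (Int.negSucc n) (T.shift (-1) α) ∈ T.U := by
      rw [shift_shift]
      refine hT.mem_U hα hn' ?_ ?_ <;> rw [Int.negSucc_eq] <;> omega
    have := hT.isEigenfunction_neg_Aminus (hT.U_subset hα') (by rw [hs]; exact hT.U_subset hα)
      (hΓ.smooth_ψNat_neg hT hα' (n := n) (by
        rw [shift_shift]; exact hT.mem_U hα hn' (by omega) (by omega)))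
      (hΓ.smooth_ψNat_neg hT hα (n := n + 1) (hT.mem_U hα hn' (by omega) (by omega)))
      (ih hα' hm) (fun x hx => hΓ.ψNat_succ_neg hT hα hα' n hx)
    rwa [hs, ← E_negSucc_succ] at this

theorem Aplus_ψNat_neg (hα : α ∈ T.U) {n : ℕ} (hn : T.shift (Int.negSucc (n + 1)) α ∈ T.U)
    {x : ℝ} (hx : x ∈ T.I) :
    T.Aplus (T.shift (-1) α) (T.ψNat (n + 1) (-α)) x =
      -T.E (Int.negSucc n) (T.shift (-1) α) * T.ψNat n (-T.shift (-1) α) x := by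
  have hn' : T.shift (-((n + 2 : ℕ) : ℤ)) α ∈ T.U := hn
  have hα' : T.shift (-1) α ∈ T.U := hT.mem_U hα hn' (by omega) (by omega)
  have hm : T.shift (Int.negSucc n) (T.shift (-1) α) ∈ T.U := by
    rw [shift_shift]
    refine hT.mem_U hα hn' ?_ ?_ <;> rw [Int.negSucc_eq] <;> omega
  exact hT.Aplus_neg_Aminus (hT.U_subset hα')
    (hΓ.smooth_ψNat_neg hT hα' (n := n) (by
        rw [shift_shift]; exact hT.mem_U hα hn' (by omega) (by omega)))
    (hΓ.isEigenfunction_ψNat_neg hT hα' hm) (fun x hx => hΓ.ψNat_succ_neg hT hα hα' n hx) hx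

end HasGammaThree

end PotentialFamily

/-! ### Darboux transformations of the Wronskians. -/

namespace PotentialFamily

variable {N : ℕ} {T : PotentialFamily N}

namespace HasGammaThree

variable (hΓ : T.HasGammaThree) (hT : T.IsTSIP) {α : Fin N → ℝ}
include hΓ hT

/-- The Darboux transformation with seed `ψ₋₁(α)` is the raising operator `A⁺(α₋₁)`. -/
theorem W_neg_one_cons (hα : α ∈ T.U) (hα' : T.shift (-1) α ∈ T.U) (L : List ℤ)
    (hL : ∀ l ∈ L, ContDiffOn ℝ ∞ (T.ψ (l - 1) α) T.I ∧ ∃ c : ℝ, c ≠ 0 ∧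
      ∀ x ∈ T.I, T.Aplus (T.shift (-1) α) (T.ψ (l - 1) α) x = c * T.ψ l (T.shift (-1) α) x) :
    ∃ C : ℝ, C ≠ 0 ∧ ∀ x ∈ T.I, T.W (-1 :: L.map (· - 1)) α x =
      C * (T.ψ₀ (-α) x * T.W L (T.shift (-1) α) x) := by
  have hn := hΓ.neg_mem α (hT.U_subset hα)
  choose hs c hc0 hc using fun j : Fin L.length => hL (L.get j) (L.get_mem j)
  refine ⟨∏ j, -c j, Finset.prod_ne_zero_iff.2 fun j _ => neg_ne_zero.2 (hc0 j), fun x hx => ?_⟩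
  have h1 : T.W (-1 :: L.map (· - 1)) α x = wronskian (Fin.cons (T.ψ₀ (-α))
      (fun j : Fin L.length => T.ψ (L.get j - 1) α) : Fin (L.length + 1) → ℝ → ℝ) x := by
    have : (-1 : ℤ) :: L.map (· - 1) = ((0 : ℤ) :: L).map (· - 1) := by simp
    rw [this, W_map]
    refine congrFun (congrArg wronskian (funext fun j => ?_)) x
    exact Fin.cases rfl (fun j => rfl) j
  rw [h1, wronskian_cons T.isOpen_I hs (hT.smooth _ hn) (hT.nodeless _ hn) hx, mul_left_comm]
  congr 1
  refine wronskian_congr_const_mul T.isOpen_I _ (fun j y hy => ?_) hx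
  have h2 := hc j y hy
  have h3 := hΓ.w₀_neg hT hα hα' hy
  rw [Aplus] at h2
  rw [w₀] at h3
  linear_combination -h2 + T.ψ (L.get j - 1) α y * h3

/-- The states `ψ₋₂(α), …, ψ₋₍ₘ₊₁₎(α)` are Darboux transforms, with seed `ψ₀(α₋₁)`, of
`ψ₋₁(α₋₁), …, ψ₋ₘ(α₋₁)`. -/
theorem W_map_sub_one (hα : α ∈ T.U) {m : ℕ} (hm : T.shift (-((m + 1 : ℕ) : ℤ)) α ∈ T.U)
    {x : ℝ} (hx : x ∈ T.I) :
    T.ψ₀ (T.shift (-1) α) x * T.W ((negTuple m).map (· - 1)) α x =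
      (-1) ^ (negTuple m).length * T.W (0 :: negTuple m) (T.shift (-1) α) x := by
  have hα' : T.shift (-1) α ∈ T.U := hT.mem_U hα hm (by omega) (by omega)
  have hD' := hT.U_subset hα'
  have hs : ∀ j : Fin (negTuple m).length,
      ContDiffOn ℝ ∞ (T.ψ ((negTuple m).get j) (T.shift (-1) α)) T.I := fun j => by
    obtain ⟨n, hn, hl⟩ := exists_of_mem_negTuple ((negTuple m).get_mem j)
    rw [hl]
    exact hΓ.smooth_ψNat_neg hT hα' (n := n) (by
      rw [shift_shift]; exact hT.mem_U hα hm (by omega) (by omega))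
  rw [W_cons_eq, W_map, show T.ψ 0 (T.shift (-1) α) = T.ψ₀ (T.shift (-1) α) from rfl,
    wronskian_cons T.isOpen_I hs (hT.smooth _ hD') (hT.nodeless _ hD') hx, mul_left_comm]
  congr 1
  refine (wronskian_congr_const_mul T.isOpen_I (fun _ => -1) (fun j y hy => ?_) hx).trans
    (by rw [Finset.prod_const, Finset.card_univ, Fintype.card_fin])
  obtain ⟨n, hn, hl⟩ := exists_of_mem_negTuple ((negTuple m).get_mem j)
  rw [hl, Int.negSucc_sub_one]
  have := hΓ.ψNat_succ_neg hT hα hα' n hy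
  simp only [ψ]
  rw [this, w₀]
  ring

theorem raises_negTuple (hα : α ∈ T.U) {m : ℕ} (hm : T.shift (-((m + 1 : ℕ) : ℤ)) α ∈ T.U)
    {l : ℤ} (hl : l ∈ negTuple m) :
    ContDiffOn ℝ ∞ (T.ψ (l - 1) α) T.I ∧ ∃ c : ℝ, c ≠ 0 ∧
      ∀ x ∈ T.I, T.Aplus (T.shift (-1) α) (T.ψ (l - 1) α) x = c * T.ψ l (T.shift (-1) α) x := by
  obtain ⟨n, hn, rfl⟩ := exists_of_mem_negTuple hl
  have hα' : T.shift (-1) α ∈ T.U := hT.mem_U hα hm (by omega) (by omega)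
  rw [Int.negSucc_sub_one]
  refine ⟨hΓ.smooth_ψNat_neg hT hα (n := n + 1) (hT.mem_U hα hm (by omega) (by omega)),
    -T.E (Int.negSucc n) (T.shift (-1) α), neg_ne_zero.2 (hT.E_negSucc_neg hα' ?_).ne, fun x hx =>
    hΓ.Aplus_ψNat_neg hT hα (hT.mem_U hα hm ?_ ?_) hx⟩
  · rw [shift_shift]
    refine hT.mem_U hα hm ?_ ?_ <;> rw [Int.negSucc_eq] <;> omega
  all_goals rw [Int.negSucc_eq]; omega

theorem exists_W_negTuple_succ (hα : α ∈ T.U) {m : ℕ}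
    (hm : T.shift (-((m + 1 : ℕ) : ℤ)) α ∈ T.U) :
    ∃ C : ℝ, C ≠ 0 ∧ ∀ x ∈ T.I, T.W (negTuple (m + 1)) α x =
      C * (T.ψ₀ (-α) x * T.W (negTuple m) (T.shift (-1) α) x) := by
  rw [negTuple_succ]
  exact hΓ.W_neg_one_cons hT hα (hT.mem_U hα hm (by omega) (by omega)) _
    fun l hl => hΓ.raises_negTuple hT hα hm hl

theorem exists_W_negTuple_succ_append (hα : α ∈ T.U) {m : ℕ}
    (hm : T.shift (-((m + 1 : ℕ) : ℤ)) α ∈ T.U) {k : ℕ}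
    (hk : ∀ j : ℕ, j ≤ k → T.shift j α ∈ T.D) :
    ∃ C : ℝ, C ≠ 0 ∧ ∀ x ∈ T.I, T.W (negTuple (m + 1) ++ [(k : ℤ)]) α x =
      C * (T.ψ₀ (-α) x * T.W (negTuple m ++ [((k + 1 : ℕ) : ℤ)]) (T.shift (-1) α) x) := by
  have h : negTuple (m + 1) ++ [(k : ℤ)] =
      -1 :: (negTuple m ++ [((k + 1 : ℕ) : ℤ)]).map (· - 1) := by
    simp [negTuple_succ]
  rw [h]
  refine hΓ.W_neg_one_cons hT hα (hT.mem_U hα hm (by omega) (by omega)) _ fun l hl => ?_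
  rcases List.mem_append.1 hl with hl | hl
  · exact hΓ.raises_negTuple hT hα hm hl
  · obtain rfl := List.mem_singleton.1 hl
    have hk1 : ((k + 1 : ℕ) : ℤ) - 1 = k := by simp
    rw [hk1]
    refine ⟨hT.smooth_ψNat hk, 1, one_ne_zero, fun x _ => ?_⟩
    rw [one_mul]
    change _ = T.Aplus (T.shift (-1) α) (T.ψNat k (T.shift 1 (T.shift (-1) α))) x
    rw [shift_shift, show (1 : ℤ) + -1 = 0 by norm_num, shift_zero]
    rfl

/-- Since k < 0, the erased index is not -1, so the seed ψ₋₁ stays in the family. -/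
theorem exists_W_negTuple_succ_erase (hα : α ∈ T.U) {m : ℕ}
    (hm : T.shift (-((m + 1 : ℕ) : ℤ)) α ∈ T.U) {k : ℤ} (hk : k < 0) :
    ∃ C : ℝ, C ≠ 0 ∧ ∀ x ∈ T.I, T.W ((negTuple (m + 1)).erase (k - 1)) α x =
      C * (T.ψ₀ (-α) x * T.W ((negTuple m).erase k) (T.shift (-1) α) x) := by
  have h : (negTuple (m + 1)).erase (k - 1) = -1 :: ((negTuple m).erase k).map (· - 1) := by
    rw [negTuple_succ, List.erase_cons_tail (by simp; omega), List.map_erase (sub_left_injective)]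
  rw [h]
  exact hΓ.W_neg_one_cons hT hα (hT.mem_U hα hm (by omega) (by omega)) _
    fun l hl => hΓ.raises_negTuple hT hα hm (List.mem_of_mem_erase hl)

end HasGammaThree

end PotentialFamily

/-- Numerators and denominators may be rescaled by constants and by a common nonvanishing
function. -/
theorem PropOn.div_of_rescale {I : Set ℝ} {f p q P Q φ : ℝ → ℝ} {C C' : ℝ}
    (h : PropOn I f fun x => p x / q x) (hφ : ∀ x ∈ I, φ x ≠ 0) (hC : C ≠ 0) (hC' : C' ≠ 0)
    (hP : ∀ x ∈ I, P x = C * (φ x * p x)) (hQ : ∀ x ∈ I, Q x = C' * (φ x * q x)) :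
    PropOn I f fun x => P x / Q x := by
  obtain ⟨c, hc, hf⟩ := h
  refine ⟨c * C' / C, by positivity, fun x hx => ?_⟩
  have := hφ x hx
  simp only [hf x hx, hP x hx, hQ x hx]
  rw [mul_div_mul_comm, mul_div_mul_left _ _ this]
  field_simp

/-! ### The induction on `m`. -/

theorem lemma5 {N : ℕ} (T : PotentialFamily N) (hT : T.IsTSIP) (hΓ : T.HasGammaThree)
    (α : Fin N → ℝ) (hα : α ∈ T.U) (m : ℕ) (hm : T.shift (-m) α ∈ T.U) :
    (∀ x ∈ T.I, T.W (negTuple m) α x ≠ 0) ∧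
    (∀ k : ℕ, (∀ j : ℕ, j ≤ k → T.shift j α ∈ T.D) →
      PropOn T.I (T.ψ (k + m) (T.shift (-m) α))
        (fun x => T.W (negTuple m ++ [(k : ℤ)]) α x / T.W (negTuple m) α x)) ∧
    (∀ k : ℤ, -(m : ℤ) ≤ k → k < 0 →
      PropOn T.I (T.ψ (k + m) (T.shift (-m) α))
        (fun x => T.W ((negTuple m).erase k) α x / T.W (negTuple m) α x)) := by
  induction m generalizing α with
  | zero =>
    refine ⟨fun x _ => ?_, fun k _ => ⟨1, one_ne_zero, fun x _ => ?_⟩, fun k h1 h2 => ?_⟩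
    · rw [show negTuple 0 = [] from rfl, PotentialFamily.W_nil]
      exact one_ne_zero
    · simp [show negTuple 0 = [] from rfl, PotentialFamily.shift_zero, PotentialFamily.W_nil,
        PotentialFamily.W_singleton]
    · simp at h1; omega
  | succ m ih =>
    have hα' : T.shift (-1) α ∈ T.U := hT.mem_U hα hm (by omega) (by omega)
    have hss : T.shift (-(m : ℤ)) (T.shift (-1) α) = T.shift (-((m + 1 : ℕ) : ℤ)) α := by
      rw [PotentialFamily.shift_shift]; congr 1; push_cast; ring
    have hn0 := hT.nodeless _ (hΓ.neg_mem α (hT.U_subset hα))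
    have hn1 := hT.nodeless _ (hT.U_subset hα')
    obtain ⟨ih1, ih2, ih3⟩ := ih (T.shift (-1) α) hα' (by rwa [hss])
    rw [hss] at ih2 ih3
    obtain ⟨C, hC, hW⟩ := hΓ.exists_W_negTuple_succ hT hα hm
    refine ⟨fun x hx => ?_, fun k hk => ?_, fun k hk1 hk2 => ?_⟩
    · rw [hW x hx]
      exact mul_ne_zero hC (mul_ne_zero (hn0 x hx) (ih1 x hx))
    · obtain ⟨C', hC', hW'⟩ := hΓ.exists_W_negTuple_succ_append hT hα hm hk
      have := ih2 (k + 1) fun j hj => by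
        rw [PotentialFamily.shift_shift]
        rcases j with _ | j
        · simpa using hT.U_subset hα'
        · simpa using hk j (by omega)
      rw [show ((k + 1 : ℕ) : ℤ) + m = k + ((m + 1 : ℕ) : ℤ) by push_cast; ring] at this
      exact this.div_of_rescale hn0 hC' hC hW' hW
    · rcases eq_or_lt_of_le (show k ≤ -1 by omega) with rfl | hk
      -- The seed itself is removed: use the induction hypothesis that adjoins ψ₀ at α₋₁. The
      -- reciprocity constant `c` absorbs ψ₀(-α)ψ₀(α₋₁), hence the scale `c⁻¹` below.
      · obtain ⟨c, hc0, hc⟩ := hΓ.ψ₀_neg hT hα hα'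
        have := ih2 0 fun j hj => by
          obtain rfl : j = 0 := by omega
          simpa [PotentialFamily.shift_zero] using hT.U_subset hα'
        rw [show ((0 : ℕ) : ℤ) + m = -1 + ((m + 1 : ℕ) : ℤ) by push_cast; ring] at this
        have he : (negTuple (m + 1)).erase (-1) = (negTuple m).map (· - 1) := by
          rw [negTuple_succ, List.erase_cons_head]
        rw [he]
        refine this.div_of_rescale hn0 (inv_ne_zero hc0) hC (fun x hx => ?_) hW
        have h1 := hΓ.W_map_sub_one hT hα hm hx
        rw [PotentialFamily.W_append_singleton, Nat.cast_zero, ← h1, ← hc x hx]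
        have := hn0 x hx
        have := hn1 x hx
        field_simp
      · obtain ⟨C', hC', hW'⟩ := hΓ.exists_W_negTuple_succ_erase hT hα hm (k := k + 1) (by omega)
        have := ih3 (k + 1) (by push_cast at hk1; omega) (by omega)
        rw [add_sub_cancel_right] at hW'
        rw [show k + 1 + (m : ℤ) = k + ((m + 1 : ℕ) : ℤ) by push_cast; ring] at this
        exact this.div_of_rescale hn0 hC' hC hW' hW
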